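/- Let $G=\prod_{j=0}^{\infty} \mathbb{Z}_2$ be the dyadic (Walsh) group with normalized Haar measure $\mu$, let $I_m(x)=\{y\in G: y_j=x_j \text{ for } 0\le j<m\}$, and let $\zeta_m$ be the $\sigma$-algebra generated by the intervals $I_m(x)$, $x\in G$. For $0<p<\infty$ the Hardy space $H_p(G)$ consists of all (real or complex) martingales $F=(F_m)_{m\in\mathbb{N}}$ with respect to $(\zeta_m)_{m\in\mathbb{N}}$ such that $\|F\|_{H_p}:=\|\sup_{m}|F_m|\|_{L_p(G)}<\infty$. Let $(w_j)_{j\ge 0}$ be the Walsh system, $w_j(x)=\prod_{i}(-1)^{j_i x_i}$ for $j=\sum_i j_i2^i$, $j_i\in\{0,1\}$. For a martingale $F$ put $\widehat F(j)=\lim_{m\to\infty}\int_G F_m w_j\,d\mu$, $S_mF=\sum_{j=0}^{m-1}\widehat F(j)w_j$ and $\sigma_mF=\frac1m\sum_{j=1}^m S_jF$ ($m\ge1$). For $0\le k\le s-1$ let $$\beta_k^s=2^s+2^{s-1}+\dots+2^k .$$ Let $n\ge 1$ be an integer. Then the restricted weighted maximal operator $$\tilde\sigma_7^{*,\nabla}F:=\sup_{s\ge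 1}\ \sup_{\max(0,\,s-[s^{1/n}]-1)\le k\le s-1}\frac{|\sigma_{\beta_k^s}F|}{\log^{2/n}\beta_k^s},$$ where $[\cdot]$ denotes the integer part, is bounded from the Hardy space $H_{1/2}(G)$ to the Lebesgue space $L_{1/2}(G)$: there is a constant $C$, depending only on $n$, such that $\tilde\sigma_7^{*,\nabla}F\in L_{1/2}(G)$ and $\|\tilde\sigma_7^{*,\nabla}F\|_{1/2}\le C\|F\|_{H_{1/2}}$ for every $F\in H_{1/2}(G)$. In particular ($n=2$), this holds for the indices $s-[\sqrt s]-1\le k\le s-1$ and the weight $\log\beta_k^s$. -/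

import Mathlib

open MeasureTheory Filter
open scoped ENNReal NNReal

namespace WalshFejer

/-- The Walsh (dyadic) group: the complete direct product of countably many copies of `Z_2`. -/
abbrev G : Type := ℕ → ZMod 2

/-- The normalized Haar measure on `G`: the product of the measures on `Z_2` for which each
singleton has measure `1/2`. -/
noncomputable def haar : Measure G :=
  Measure.infinitePi fun _ : ℕ => (PMF.uniformOfFintype (ZMod 2)).toMeasure

/-- The dyadic interval `I_n(x)`. -/
def interval (n : ℕ) (x : G) : Set G := {y | ∀ j < n, y j = x j}

theorem measurableSet_interval (n : ℕ) (x : G) : MeasurableSet (interval n x) := by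
  have h : interval n x = ⋂ j ∈ Finset.range n, (fun y : G => y j) ⁻¹' {x j} := by
    ext y; simp [interval]
  rw [h]
  exact Finset.measurableSet_biInter _ fun j _ =>
    measurable_pi_apply j (MeasurableSet.singleton (x j))

/-- Each interval of rank `n` is the union of two intervals of rank `n + 1`. -/
theorem interval_eq_union (n : ℕ) (x : G) :
    interval n x =
      interval (n + 1) (Function.update x n 0) ∪ interval (n + 1) (Function.update x n 1) := by
  have two : ∀ a : ZMod 2, a = 0 ∨ a = 1 := by decide
  ext y
  simp only [interval, Set.mem_ofPred_eq, Set.mem_union]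
  constructor
  · intro h
    refine (two (y n)).imp (fun hy j hj => ?_) (fun hy j hj => ?_) <;>
    · rcases Nat.lt_succ_iff_lt_or_eq.mp hj with hj | rfl
      · rw [Function.update_of_ne hj.ne]; exact h j hj
      · rw [Function.update_self]; exact hy
  · rintro (h | h) j hj <;>
    · have := h j (by omega)
      rwa [Function.update_of_ne hj.ne] at this

/-- The dyadic filtration: `ζ_n` is the σ-algebra generated by the intervals `I_n(x)`, `x ∈ G`. -/
def dyadicFiltration : Filtration ℕ (inferInstance : MeasurableSpace G) where
  seq n := MeasurableSpace.generateFrom (Set.range (interval n))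
  mono' := by
    refine monotone_nat_of_le_succ fun n => MeasurableSpace.generateFrom_le ?_
    rintro _ ⟨x, rfl⟩
    rw [interval_eq_union]
    exact MeasurableSet.union (MeasurableSpace.measurableSet_generateFrom ⟨_, rfl⟩)
      (MeasurableSpace.measurableSet_generateFrom ⟨_, rfl⟩)
  le' n := by
    refine MeasurableSpace.generateFrom_le ?_
    rintro _ ⟨x, rfl⟩
    exact measurableSet_interval n x

/-- The `k`-th Rademacher function `r_k(x) = (-1)^{x_k}`. -/
def rademacher (k : ℕ) (x : G) : ℝ := (-1) ^ (x k).val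

/-- The `n`-th Walsh function `w_n = ∏_k r_k^{n_k}`, where `n = ∑_k n_k 2^k` is the binary
expansion of `n` (all binary digits with index at least `Nat.size n` vanish). -/
def walsh (n : ℕ) (x : G) : ℝ :=
  ∏ k ∈ Finset.range (Nat.size n), rademacher k x ^ (n.testBit k).toNat

section Martingales

variable {𝕜 : Type*} [RCLike 𝕜]

/-- The maximal function `F^* = sup_n |F_n|`. -/
noncomputable def maximalFunction (F : ℕ → G → 𝕜) (x : G) : ℝ≥0∞ := ⨆ n, ‖F n x‖ₑ

/-- The (quasi-)norm `‖F‖_{H_p} = ‖F^*‖_p`. -/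
noncomputable def hardyNorm (p : ℝ≥0∞) (F : ℕ → G → 𝕜) : ℝ≥0∞ :=
  eLpNorm (maximalFunction F) p haar

/-- `F` belongs to the martingale Hardy space `H_p(G)`: it is a martingale with respect to the
dyadic filtration, and `‖F‖_{H_p} < ∞`. -/
def MemHardy (p : ℝ≥0∞) (F : ℕ → G → 𝕜) : Prop :=
  Martingale F dyadicFiltration haar ∧ hardyNorm p F < ∞

/-- The `k`-th Walsh–Fourier coefficient of a martingale, `lim_n ∫ F_n w_k` (for a martingale the
sequence is eventually constant, so that the limit exists). -/
noncomputable def fourierCoeff (F : ℕ → G → 𝕜) (k : ℕ) : 𝕜 :=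
  limUnder atTop fun n : ℕ => ∫ x, F n x * (walsh k x : 𝕜) ∂haar

/-- The partial sum `S_n F = ∑_{k < n} F̂(k) w_k`. -/
noncomputable def partialSum (F : ℕ → G → 𝕜) (n : ℕ) (x : G) : 𝕜 :=
  ∑ k ∈ Finset.range n, fourierCoeff F k * (walsh k x : 𝕜)

/-- The Fejér mean `σ_n F = (1/n) ∑_{k=1}^n S_k F` (used for `n ≥ 1`). -/
noncomputable def fejerMean (F : ℕ → G → 𝕜) (n : ℕ) (x : G) : 𝕜 :=
  (n : 𝕜)⁻¹ * ∑ k ∈ Finset.Icc 1 n, partialSum F k x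

/-- `β_k^s = 2^s + 2^{s-1} + ⋯ + 2^k`. -/
def beta (s k : ℕ) : ℕ := ∑ j ∈ Finset.Icc k s, 2 ^ j

/-- The integer part of the `n`-th root of `s`. -/
noncomputable def rootFloor (n s : ℕ) : ℕ := ⌊(s : ℝ) ^ (1 / (n : ℝ))⌋₊

/-- The restricted weighted maximal operator
`sup_s sup_k |σ_{β_k^s} F| / log^{2/n} β_k^s`, the inner supremum being over the indices
`0 ≤ k` with `s - [s^{1/n}] - 1 ≤ k ≤ s - 1`. (Such indices exist only for `s ≥ 1`, and then
`β_k^s ≥ 3`, so that the weights are positive.) -/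
noncomputable def restrictedMaximal (n : ℕ) (F : ℕ → G → 𝕜) (x : G) : ℝ≥0∞ :=
  ⨆ (s : ℕ) (k : ℕ) (_ : k + 1 ≤ s ∧ s ≤ k + rootFloor n s + 1),
    ‖fejerMean F (beta s k) x‖ₑ / ENNReal.ofReal (Real.log (beta s k : ℝ) ^ (2 / (n : ℝ)))

end Martingales

end WalshFejer

/-
On `G` the absolute value of the kernel of `σ_{β_k^s}` is at most the sum over the blocks
`k ≤ j ≤ s` of `2 ∑_{t ≤ j} 2^t D_{2^j}(· + e_t)`, divided by `β_k^s ≥ 2^s`. As `F_{s+1}` and the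
kernel depend on `s + 1` coordinates only, taking the square root of the convolution under the
integral sign costs a factor `2^{(s+1)/2}`, and subadditivity of the square root gives
`|σ_{β_k^s} F|^{1/2} ≤ 2 ∑_{k ≤ j ≤ s} A_j f_{s+1}`, where `f_l = |F_l|^{1/2}` and `A_j` is a
geometrically weighted sum of translated dyadic means. Now replace `f_{s+1}` by the sum over
`l ≤ s + 1` of the increments `d_l` of the running maximum of `f`. Since `d_l` depends on `l`
coordinates only, the `A_j d_l` with `j ≥ l` are `O(d_l)` up to a geometric series. After division
by the window length `ρ(s)`, those with `j < l` are dominated by one average over a window of length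
`ρ(l - 1)`, because `ρ` is monotone and grows by at most one at each step. The resulting majorants
do not depend on `s` and `k`, and their integrals add up to
`O(∑_l ∫ d_l) = O(∫ sup_l |F_l|^{1/2})`.
-/

namespace WalshFejer

section WalshSystem

theorem add_mem_interval_iff {n : ℕ} {x y z : G} :
    x + y ∈ interval n z ↔ y ∈ interval n (x + z) :=
  forall₂_congr fun j _ => by
    rw [Pi.add_apply, Pi.add_apply, add_comm, CharTwo.add_eq_iff_eq_add, add_comm]

theorem rademacher_add (k : ℕ) (x y : G) :
    rademacher k (x + y) = rademacher k x * rademacher k y := by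
  have cases_zmod : ∀ a : ZMod 2, a = 0 ∨ a = 1 := by decide
  rw [rademacher, rademacher, rademacher, Pi.add_apply]
  rcases cases_zmod (x k) with hx | hx <;> rcases cases_zmod (y k) with hy | hy <;>
    simp [hx, hy, ZMod.val_one, CharTwo.add_self_eq_zero]

theorem abs_rademacher (k : ℕ) (x : G) : |rademacher k x| = 1 := by
  simp [rademacher, abs_pow]

theorem one_add_rademacher (k : ℕ) (x : G) :
    1 + rademacher k x = if x k = 0 then 2 else 0 := by
  have cases_zmod : ∀ a : ZMod 2, a = 0 ∨ a = 1 := by decide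
  rcases cases_zmod (x k) with h | h <;> norm_num [rademacher, h, ZMod.val_one]

theorem walsh_eq_prod {n m : ℕ} (h : n < 2 ^ m) (x : G) :
    walsh n x = ∏ k ∈ Finset.range m, rademacher k x ^ (n.testBit k).toNat := by
  refine Finset.prod_subset (Finset.range_subset_range.2 (Nat.size_le.2 h)) fun k _ hk => ?_
  have : n < 2 ^ k := Nat.size_le.1 (not_lt.1 (mt Finset.mem_range.2 hk))
  rw [Nat.testBit_eq_false_of_lt this, Bool.toNat_false, pow_zero]

theorem walsh_zero (x : G) : walsh 0 x = 1 := by simp [walsh]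

theorem walsh_add (n : ℕ) (x y : G) : walsh n (x + y) = walsh n x * walsh n y := by
  simp only [walsh, rademacher_add, mul_pow, Finset.prod_mul_distrib]

theorem dependsOn_walsh {n m : ℕ} (h : n < 2 ^ m) : DependsOn (walsh n) (Set.Iio m) := by
  intro x y hxy
  rw [walsh_eq_prod h, walsh_eq_prod h]
  refine Finset.prod_congr rfl fun k hk => ?_
  rw [rademacher, rademacher, hxy k (Finset.mem_range.1 hk)]

theorem walsh_two_pow_add {i j : ℕ} (h : i < 2 ^ j) (x : G) :
    walsh (2 ^ j + i) x = rademacher j x * walsh i x := by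
  rw [walsh_eq_prod (m := j + 1) (by rw [pow_succ]; omega), Finset.prod_range_succ,
    walsh_eq_prod h, mul_comm, Nat.testBit_two_pow_add_eq, Nat.testBit_eq_false_of_lt h,
    Bool.not_false, Bool.toNat_true, pow_one]
  refine congrArg _ (Finset.prod_congr rfl fun k hk => ?_)
  rw [Nat.testBit_two_pow_add_gt (Finset.mem_range.1 hk)]

/-- The point of `G` whose only nonzero coordinate has index `t`. -/
def basisPoint (t : ℕ) : G := Pi.single t 1

theorem rademacher_add_basisPoint_self (t : ℕ) (x : G) :
    rademacher t (x + basisPoint t) = -rademacher t x := by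
  rw [rademacher_add]
  simp [rademacher, basisPoint, ZMod.val_one]

theorem rademacher_add_basisPoint_of_ne {k t : ℕ} (h : k ≠ t) (x : G) :
    rademacher k (x + basisPoint t) = rademacher k x := by
  rw [rademacher_add]
  simp [rademacher, basisPoint, h]

theorem apply_add_basisPoint_of_dependsOn {α : Type*} {f : G → α} {m t : ℕ}
    (hf : DependsOn f (Set.Iio m)) (h : m ≤ t) (x : G) : f (x + basisPoint t) = f x :=
  hf fun i hi => by simp [basisPoint, ((Set.mem_Iio.1 hi).trans_le h).ne]

end WalshSystem

section Kernels

/-- The Walsh–Dirichlet kernel `D_m = ∑_{i < m} w_i`. -/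
noncomputable def dirichlet (m : ℕ) (x : G) : ℝ := ∑ i ∈ Finset.range m, walsh i x

/-- The Walsh–Fejér kernel without its normalising factor, `M K_M = ∑_{m=1}^M D_m`; without the
factor the kernels of dyadic blocks add up. -/
noncomputable def fejerSum (M : ℕ) (x : G) : ℝ := ∑ m ∈ Finset.range M, dirichlet (m + 1) x

theorem dependsOn_dirichlet {M m : ℕ} (h : M ≤ 2 ^ m) :
    DependsOn (dirichlet M) (Set.Iio m) := fun _ _ hxy =>
  Finset.sum_congr rfl fun _ hi => dependsOn_walsh ((Finset.mem_range.1 hi).trans_le h) hxy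

theorem dependsOn_fejerSum {M m : ℕ} (h : M ≤ 2 ^ m) : DependsOn (fejerSum M) (Set.Iio m) :=
  fun _ _ hxy => Finset.sum_congr rfl fun _ hi =>
    dependsOn_dirichlet ((Finset.mem_range.1 hi).trans_le h) hxy

theorem dirichlet_two_pow_add {m j : ℕ} (h : m ≤ 2 ^ j) (x : G) :
    dirichlet (2 ^ j + m) x = dirichlet (2 ^ j) x + rademacher j x * dirichlet m x := by
  rw [dirichlet, Finset.sum_range_add, dirichlet, dirichlet, Finset.mul_sum]
  exact congrArg _ (Finset.sum_congr rfl fun i hi =>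
    walsh_two_pow_add ((Finset.mem_range.1 hi).trans_le h) x)

theorem fejerSum_two_pow_add {m j : ℕ} (h : m ≤ 2 ^ j) (x : G) :
    fejerSum (2 ^ j + m) x =
      fejerSum (2 ^ j) x + (m * dirichlet (2 ^ j) x + rademacher j x * fejerSum m x) := by
  have hblock (i : ℕ) (hi : i ∈ Finset.range m) : dirichlet (2 ^ j + i + 1) x =
      dirichlet (2 ^ j) x + rademacher j x * dirichlet (i + 1) x := by
    rw [add_assoc, dirichlet_two_pow_add ((Finset.mem_range.1 hi).trans_le h)]
  rw [fejerSum, Finset.sum_range_add, Finset.sum_congr rfl hblock, Finset.sum_add_distrib,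
    Finset.sum_const, Finset.card_range, nsmul_eq_mul, ← Finset.mul_sum]
  rfl

theorem dirichlet_two_pow_succ (j : ℕ) (x : G) :
    dirichlet (2 ^ (j + 1)) x = (1 + rademacher j x) * dirichlet (2 ^ j) x := by
  rw [pow_succ, mul_two, dirichlet_two_pow_add le_rfl, one_add_mul]

theorem dirichlet_two_pow (j : ℕ) (x : G) :
    dirichlet (2 ^ j) x = (interval j 0).indicator (fun _ => 2 ^ j) x := by
  classical
  induction j with
  | zero => simp [dirichlet, walsh_zero, interval]
  | succ j ih =>
    have hmem : x ∈ interval (j + 1) 0 ↔ x j = 0 ∧ x ∈ interval j 0 :=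
      Nat.forall_lt_succ_right.trans and_comm
    rw [dirichlet_two_pow_succ, ih, one_add_rademacher, Set.indicator_apply, Set.indicator_apply,
      ite_zero_mul_ite_zero, if_congr hmem rfl rfl, pow_succ']

theorem dirichlet_two_pow_add_apply (j : ℕ) (x z : G) :
    dirichlet (2 ^ j) (x + z) = (interval j z).indicator (fun _ => 2 ^ j) x := by
  classical
  rw [dirichlet_two_pow, Set.indicator_apply, Set.indicator_apply, add_comm x,
    add_mem_interval_iff, add_zero]

theorem dirichlet_two_pow_nonneg (j : ℕ) (x : G) : 0 ≤ dirichlet (2 ^ j) x := by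
  rw [dirichlet_two_pow]
  exact Set.indicator_nonneg (fun _ _ => by positivity) x

theorem dirichlet_two_pow_add_basisPoint_of_lt {j t : ℕ} (h : t < j) (x : G) :
    dirichlet (2 ^ (j + 1)) (x + basisPoint t) =
      (1 + rademacher j x) * dirichlet (2 ^ j) (x + basisPoint t) := by
  rw [dirichlet_two_pow_succ, rademacher_add_basisPoint_of_ne h.ne']

/-- The sum `∑_{t ≤ j} 2^t D_{2^j}(x + e_t)` of translates of the Dirichlet kernel, the essential
part of the Fejér kernel of order `2^j`. -/
noncomputable def dirichletTranslates (j : ℕ) (x : G) : ℝ :=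
  ∑ t ∈ Finset.range (j + 1), 2 ^ t * dirichlet (2 ^ j) (x + basisPoint t)

theorem dirichletTranslates_succ (j : ℕ) (x : G) :
    dirichletTranslates (j + 1) x = (1 + rademacher j x) * dirichletTranslates j x +
      2 ^ (j + 1) * dirichlet (2 ^ j) x := by
  have hlt : ∑ t ∈ Finset.range j, 2 ^ t * dirichlet (2 ^ (j + 1)) (x + basisPoint t) =
      (1 + rademacher j x) *
        ∑ t ∈ Finset.range j, 2 ^ t * dirichlet (2 ^ j) (x + basisPoint t) := by
    rw [Finset.mul_sum]
    refine Finset.sum_congr rfl fun t ht => ?_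
    rw [dirichlet_two_pow_add_basisPoint_of_lt (Finset.mem_range.1 ht), mul_left_comm]
  have hself : dirichlet (2 ^ (j + 1)) (x + basisPoint j) =
      (1 - rademacher j x) * dirichlet (2 ^ j) x := by
    rw [dirichlet_two_pow_succ, rademacher_add_basisPoint_self, ← sub_eq_add_neg,
      apply_add_basisPoint_of_dependsOn (dependsOn_dirichlet le_rfl) le_rfl]
  rw [dirichletTranslates, dirichletTranslates, Finset.sum_range_succ, Finset.sum_range_succ,
    Finset.sum_range_succ, hlt, hself,
    apply_add_basisPoint_of_dependsOn (dependsOn_dirichlet le_rfl) le_rfl,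
    apply_add_basisPoint_of_dependsOn (dependsOn_dirichlet le_rfl) le_rfl,
    dirichlet_two_pow_succ]
  ring

theorem two_mul_fejerSum_two_pow (j : ℕ) (x : G) :
    2 * fejerSum (2 ^ j) x = dirichlet (2 ^ j) x + dirichletTranslates j x := by
  induction j with
  | zero => simp [fejerSum, dirichletTranslates, dirichlet, walsh_zero, one_add_one_eq_two]
  | succ j ih =>
    have hrec : fejerSum (2 ^ (j + 1)) x =
        (1 + rademacher j x) * fejerSum (2 ^ j) x + 2 ^ j * dirichlet (2 ^ j) x := by
      rw [pow_succ, mul_two, fejerSum_two_pow_add le_rfl, Nat.cast_pow, Nat.cast_two]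
      ring
    rw [hrec, dirichletTranslates_succ, dirichlet_two_pow_succ]
    linear_combination (1 + rademacher j x) * ih

theorem two_pow_mul_dirichlet_le_dirichletTranslates (j : ℕ) (x : G) :
    2 ^ j * dirichlet (2 ^ j) x ≤ dirichletTranslates j x := by
  rw [← apply_add_basisPoint_of_dependsOn (dependsOn_dirichlet (le_refl (2 ^ j))) le_rfl x]
  exact Finset.single_le_sum
    (f := fun t => (2 : ℝ) ^ t * dirichlet (2 ^ j) (x + basisPoint t))
    (fun t _ => mul_nonneg (by positivity) (dirichlet_two_pow_nonneg j _))
    (Finset.self_mem_range_succ j)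

theorem fejerSum_two_pow_nonneg (j : ℕ) (x : G) : 0 ≤ fejerSum (2 ^ j) x := by
  have hD := dirichlet_two_pow_nonneg j x
  have hT : 0 ≤ dirichletTranslates j x :=
    le_trans (by positivity) (two_pow_mul_dirichlet_le_dirichletTranslates j x)
  linarith [two_mul_fejerSum_two_pow j x]

theorem fejerSum_add_two_pow_mul_dirichlet_le (j : ℕ) (x : G) :
    fejerSum (2 ^ j) x + 2 ^ j * dirichlet (2 ^ j) x ≤ 2 * dirichletTranslates j x := by
  have hle := two_pow_mul_dirichlet_le_dirichletTranslates j x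
  have hD : dirichlet (2 ^ j) x ≤ 2 ^ j * dirichlet (2 ^ j) x :=
    le_mul_of_one_le_left (dirichlet_two_pow_nonneg j x) (one_le_pow₀ one_le_two)
  linarith [two_mul_fejerSum_two_pow j x]

theorem beta_self (k : ℕ) : beta k k = 2 ^ k := by simp [beta]

theorem beta_succ {s k : ℕ} (h : k ≤ s + 1) : beta (s + 1) k = 2 ^ (s + 1) + beta s k := by
  rw [beta, beta, Finset.sum_Icc_succ_top h, add_comm]

theorem beta_lt (s k : ℕ) : beta s k < 2 ^ (s + 1) :=
  Nat.geomSum_lt le_rfl fun _ hj => Nat.lt_succ_of_le (Finset.mem_Icc.1 hj).2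

theorem two_pow_le_beta {s k : ℕ} (h : k ≤ s) : 2 ^ s ≤ beta s k :=
  Finset.single_le_sum (f := fun j => 2 ^ j) (fun _ _ => Nat.zero_le _)
    (Finset.mem_Icc.2 ⟨h, le_rfl⟩)

theorem abs_fejerSum_beta_le {s k : ℕ} (h : k ≤ s) (x : G) :
    |fejerSum (beta s k) x| ≤ ∑ j ∈ Finset.Icc k s, 2 * dirichletTranslates j x := by
  induction s, h using Nat.le_induction with
  | base =>
    have hD := dirichlet_two_pow_nonneg k x
    rw [beta_self, abs_of_nonneg (fejerSum_two_pow_nonneg k x), Finset.Icc_self,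
      Finset.sum_singleton]
    exact (le_add_of_nonneg_right (by positivity)).trans
      (fejerSum_add_two_pow_mul_dirichlet_le k x)
  | succ s hks ih =>
    have hD := dirichlet_two_pow_nonneg (s + 1) x
    have hβ : (beta s k : ℝ) ≤ 2 ^ (s + 1) := by exact_mod_cast (beta_lt s k).le
    rw [beta_succ (hks.trans s.le_succ), fejerSum_two_pow_add (beta_lt s k).le,
      Finset.sum_Icc_succ_top (hks.trans s.le_succ)]
    calc _ ≤ |fejerSum (2 ^ (s + 1)) x| + (|beta s k * dirichlet (2 ^ (s + 1)) x| +
          |rademacher (s + 1) x * fejerSum (beta s k) x|) :=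
          (abs_add_le _ _).trans (add_le_add_right (abs_add_le _ _) _)
      _ = fejerSum (2 ^ (s + 1)) x + (beta s k * dirichlet (2 ^ (s + 1)) x +
          |fejerSum (beta s k) x|) := by
          rw [abs_of_nonneg (fejerSum_two_pow_nonneg _ x), abs_mul (rademacher _ _),
            abs_rademacher, one_mul, abs_of_nonneg (by positivity)]
      _ ≤ fejerSum (2 ^ (s + 1)) x + (2 ^ (s + 1) * dirichlet (2 ^ (s + 1)) x +
          ∑ j ∈ Finset.Icc k s, 2 * dirichletTranslates j x) := by gcongr
      _ ≤ _ := by linarith [fejerSum_add_two_pow_mul_dirichlet_le (s + 1) x]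

end Kernels

section Haar

instance : IsProbabilityMeasure haar := by unfold haar; infer_instance

instance : haar.IsAddLeftInvariant where
  map_add_left_eq_self x := by
    have hinv (i : ℕ) : (PMF.uniformOfFintype (ZMod 2)).toMeasure.map (x i + ·) =
        (PMF.uniformOfFintype (ZMod 2)).toMeasure := by
      refine Measure.ext_of_singleton fun a => ?_
      rw [Measure.map_apply (measurable_const_add _) (.singleton a),
        Set.preimage_add_left_singleton]
      simp
    exact (Measure.infinitePi_map_pi _ fun i => measurable_const_add (x i)).trans
      (congrArg _ (funext hinv))

theorem haar_interval (m : ℕ) (x : G) : haar (interval m x) = (2 ^ m)⁻¹ := by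
  have hpi : interval m x = (Finset.range m : Set ℕ).pi fun j => {x j} := by
    ext y
    simp [interval]
  rw [hpi, haar, Measure.infinitePi_pi _ fun _ _ => .singleton _]
  simp [ENNReal.inv_pow]

theorem dependsOn_interval (m : ℕ) : DependsOn (interval m) (Set.Iio m) := fun x y hxy => by
  ext z
  exact forall₂_congr fun j hj => by rw [hxy j hj]

theorem finite_range_of_dependsOn {α : Type*} {m : ℕ} {f : G → α}
    (hf : DependsOn f (Set.Iio m)) : (Set.range f).Finite := by
  have : Nonempty α := ⟨f 0⟩
  obtain ⟨g, rfl⟩ := dependsOn_iff_exists_comp.1 hf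
  exact (Set.finite_range g).subset (Set.range_comp_subset_range _ g)

theorem dependsOn_comp_const_add {α : Type*} {m : ℕ} {f : G → α} (hf : DependsOn f (Set.Iio m))
    (x : G) : DependsOn (fun y => f (x + y)) (Set.Iio m) := fun _ _ hyz =>
  hf fun i hi => congrArg (x i + ·) (hyz i hi)

theorem dependsOn_of_measurable {α : Type*} [MeasurableSpace α] [MeasurableSingletonClass α]
    {m : ℕ} {f : G → α} (hf : Measurable[dyadicFiltration m] f) : DependsOn f (Set.Iio m) := by
  have hle : dyadicFiltration m ≤
      MeasurableSpace.comap (Set.Iio m).domRestrict inferInstance := by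
    refine MeasurableSpace.generateFrom_le ?_
    rintro _ ⟨x, rfl⟩
    refine ⟨{(Set.Iio m).domRestrict x}, .singleton _, ?_⟩
    ext y
    simp [interval, funext_iff]
  exact dependsOn_iff_factorsThrough.2 (hf.mono hle le_rfl).factorsThrough

theorem measurable_dyadicFiltration_of_dependsOn {α : Type*} [MeasurableSpace α] {m : ℕ}
    {f : G → α} (hf : DependsOn f (Set.Iio m)) : Measurable[dyadicFiltration m] f := by
  intro A _
  have hA : f ⁻¹' A = ⋃₀ {I ∈ Set.range (interval m) | I ⊆ f ⁻¹' A} := by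
    refine Set.Subset.antisymm (fun x hx => ?_) (Set.sUnion_subset fun I hI => hI.2)
    refine ⟨interval m x, ⟨⟨x, rfl⟩, fun y hy => ?_⟩, fun _ _ => rfl⟩
    rwa [Set.mem_preimage, hf hy]
  rw [hA]
  exact .sUnion
    ((finite_range_of_dependsOn (dependsOn_interval m)).subset (Set.sep_subset _ _)).countable
    fun I hI => MeasurableSpace.measurableSet_generateFrom hI.1

theorem measurable_of_dependsOn {α : Type*} [MeasurableSpace α] {m : ℕ} {f : G → α}
    (hf : DependsOn f (Set.Iio m)) : Measurable f :=
  (measurable_dyadicFiltration_of_dependsOn hf).mono (dyadicFiltration.le m) le_rfl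

theorem integrable_of_dependsOn {E : Type*} [NormedAddCommGroup E] [MeasurableSpace E]
    [BorelSpace E] [SecondCountableTopology E] {m : ℕ} {f : G → E}
    (hf : DependsOn f (Set.Iio m)) : Integrable f haar := by
  obtain ⟨C, hC⟩ := (finite_range_of_dependsOn hf).isBounded.exists_norm_le
  exact .of_bound (measurable_of_dependsOn hf).aestronglyMeasurable C
    (.of_forall fun x => hC _ (Set.mem_range_self x))

/-- The conditional expectation `E_j d` with respect to `ζ_j`, as the average of `d` over the
dyadic intervals of rank `j`. -/
noncomputable def dyadicMean (j : ℕ) (d : G → ℝ≥0∞) (x : G) : ℝ≥0∞ :=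
  ⨍⁻ y in interval j x, d y ∂haar

theorem dyadicMean_eq_mul (j : ℕ) (d : G → ℝ≥0∞) (x : G) :
    dyadicMean j d x = 2 ^ j * ∫⁻ y in interval j x, d y ∂haar := by
  rw [dyadicMean, setLAverage_eq, haar_interval, div_eq_mul_inv, inv_inv, mul_comm]

theorem dependsOn_dyadicMean (j : ℕ) (d : G → ℝ≥0∞) :
    DependsOn (dyadicMean j d) (Set.Iio j) := fun x y hxy => by
  rw [dyadicMean, dyadicMean, dependsOn_interval j hxy]

theorem dyadicMean_mono (j : ℕ) {d d' : G → ℝ≥0∞} (h : d ≤ d') :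
    dyadicMean j d ≤ dyadicMean j d' := fun _ => lintegral_mono h

theorem dyadicMean_sum (j : ℕ) {ι : Type*} (s : Finset ι) {d : ι → G → ℝ≥0∞}
    (hd : ∀ i ∈ s, Measurable (d i)) (x : G) :
    dyadicMean j (fun y => ∑ i ∈ s, d i y) x = ∑ i ∈ s, dyadicMean j (d i) x :=
  lintegral_finsetSum' _ fun i hi => (hd i hi).aemeasurable

theorem dyadicMean_of_dependsOn {l j : ℕ} (h : l ≤ j) {d : G → ℝ≥0∞}
    (hd : DependsOn d (Set.Iio l)) : dyadicMean j d = d := by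
  ext x
  have hconst : Set.EqOn d (fun _ => d x) (interval j x) := fun y hy =>
    hd fun i hi => hy i (lt_of_lt_of_le hi h)
  rw [dyadicMean, setLAverage_congr_fun (measurableSet_interval j x) hconst, setLAverage_const]
  · simp [haar_interval]
  · exact measure_ne_top _ _

theorem lintegral_indicator_interval_add_mul (j : ℕ) (x z : G) (g : G → ℝ≥0∞) :
    ∫⁻ y, (interval j z).indicator 1 (x + y) * g y ∂haar = (2 ^ j)⁻¹ * dyadicMean j g (x + z) := by
  classical
  rw [dyadicMean_eq_mul, ← mul_assoc, ENNReal.inv_mul_cancel (by simp) (by simp), one_mul,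
    ← lintegral_indicator (measurableSet_interval j _)]
  refine lintegral_congr fun y => ?_
  simp only [Set.indicator_apply, add_mem_interval_iff, Pi.one_apply, ite_mul, one_mul, zero_mul]

theorem lintegral_dyadicMean (j : ℕ) {d : G → ℝ≥0∞} (hd : Measurable d) :
    ∫⁻ x, dyadicMean j d x ∂haar = ∫⁻ x, d x ∂haar := by
  have hmean (x : G) : dyadicMean j d x =
      2 ^ j * ∫⁻ y, (interval j 0).indicator 1 (x + y) * d y ∂haar := by
    rw [lintegral_indicator_interval_add_mul, add_zero, ← mul_assoc,
      ENNReal.mul_inv_cancel (by simp) (by simp), one_mul]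
  have hind : Measurable ((interval j 0).indicator (1 : G → ℝ≥0∞)) :=
    measurable_one.indicator (measurableSet_interval j 0)
  have hmeas : Measurable fun p : G × G => (interval j 0).indicator 1 (p.1 + p.2) * d p.2 :=
    (hind.comp measurable_add).mul (hd.comp measurable_snd)
  have hkernel (y : G) :
      ∫⁻ x, (interval j 0).indicator 1 (x + y) * d y ∂haar = (2 ^ j)⁻¹ * d y := by
    have hshift : Measurable fun x => (interval j 0).indicator (1 : G → ℝ≥0∞) (x + y) :=
      hind.comp (measurable_add_const y)
    rw [lintegral_mul_const _ hshift,
      lintegral_add_right_eq_self ((interval j 0).indicator (1 : G → ℝ≥0∞)),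
      lintegral_indicator_one (measurableSet_interval j 0), haar_interval]
  simp only [hmean]
  rw [lintegral_const_mul _ hmeas.lintegral_prod_right',
    lintegral_lintegral_swap hmeas.aemeasurable]
  simp only [hkernel]
  rw [lintegral_const_mul _ hd, ← mul_assoc, ENNReal.mul_inv_cancel (by simp) (by simp), one_mul]

theorem le_two_pow_mul_lintegral {m : ℕ} {h : G → ℝ≥0∞} (hh : DependsOn h (Set.Iio m)) (x : G) :
    h x ≤ 2 ^ m * ∫⁻ y, h y ∂haar := by
  rw [← congrFun (dyadicMean_of_dependsOn le_rfl hh) x, dyadicMean_eq_mul]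
  gcongr
  exact Measure.restrict_le_self

theorem lintegral_rpow_le_of_dependsOn {m : ℕ} {h : G → ℝ≥0∞} (hh : DependsOn h (Set.Iio m))
    {p : ℝ} (hp : 0 < p) (hp1 : p ≤ 1) :
    (∫⁻ y, h y ∂haar) ^ p ≤ (2 ^ m) ^ (1 - p) * ∫⁻ y, h y ^ p ∂haar := by
  set J := ∫⁻ y, h y ^ p ∂haar
  have hq : 0 ≤ 1 - p := sub_nonneg.2 hp1
  have hsup (y : G) : h y ^ (1 - p) ≤ (2 ^ m * J) ^ ((1 - p) / p) := by
    have hpow : DependsOn (fun y => h y ^ p) (Set.Iio m) := fun _ _ hxy => by simp only [hh hxy]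
    calc h y ^ (1 - p) = (h y ^ p) ^ ((1 - p) / p) := by
          rw [← ENNReal.rpow_mul, mul_div_cancel₀ _ hp.ne']
      _ ≤ _ := by gcongr; exact le_two_pow_mul_lintegral hpow y
  have hint : ∫⁻ y, h y ∂haar ≤ (2 ^ m * J) ^ ((1 - p) / p) * J :=
    calc ∫⁻ y, h y ∂haar = ∫⁻ y, h y ^ (1 - p) * h y ^ p ∂haar := lintegral_congr fun y => by
          rw [← ENNReal.rpow_add_of_nonneg _ _ hq hp.le, sub_add_cancel, ENNReal.rpow_one]
      _ ≤ ∫⁻ y, (2 ^ m * J) ^ ((1 - p) / p) * h y ^ p ∂haar := by gcongr with y; exact hsup y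
      _ = _ := lintegral_const_mul _ ((measurable_of_dependsOn hh).pow_const p)
  calc (∫⁻ y, h y ∂haar) ^ p ≤ ((2 ^ m * J) ^ ((1 - p) / p) * J) ^ p := by gcongr
    _ = (2 ^ m) ^ (1 - p) * (J ^ (1 - p) * J ^ p) := by
      rw [ENNReal.mul_rpow_of_nonneg _ _ hp.le, ← ENNReal.rpow_mul, div_mul_cancel₀ _ hp.ne',
        ENNReal.mul_rpow_of_nonneg _ _ hq, mul_assoc]
    _ = (2 ^ m) ^ (1 - p) * J := by
      rw [← ENNReal.rpow_add_of_nonneg _ _ hq hp.le, sub_add_cancel, ENNReal.rpow_one]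

end Haar

section WeightedMeans

/-- The ratio `1/√2` of the geometric weights in `weightedMean`. -/
noncomputable def ratio : ℝ≥0∞ := 2 ^ (-(1 / 2) : ℝ)

theorem two_pow_add_rpow_half {t j : ℕ} (h : t ≤ j) :
    ((2 : ℝ≥0∞) ^ (t + j)) ^ (1 / 2 : ℝ) = ratio ^ (j - t) * 2 ^ j := by
  rw [ratio, ← ENNReal.rpow_natCast, ← ENNReal.rpow_natCast, ← ENNReal.rpow_natCast,
    ← ENNReal.rpow_mul, ← ENNReal.rpow_mul,
    ← ENNReal.rpow_add _ _ two_ne_zero ENNReal.ofNat_ne_top]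
  push_cast [Nat.cast_sub h]
  ring_nf

/-- The sum `∑_{i ≥ 0} 2^{-i/2}` of the geometric weights. -/
noncomputable def geomConst : ℝ≥0∞ := (1 - ratio)⁻¹

theorem geomConst_ne_top : geomConst ≠ ∞ := by
  have hratio : ratio < 1 :=
    ENNReal.rpow_lt_one_of_one_lt_of_neg ENNReal.one_lt_two (by norm_num)
  simpa [geomConst, tsub_eq_zero_iff_le] using hratio

theorem sum_ratio_pow_le {s : Finset ℕ} {f : ℕ → ℕ} (hf : Set.InjOn f s) :
    ∑ i ∈ s, ratio ^ f i ≤ geomConst := by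
  rw [← Finset.sum_image (f := fun i => ratio ^ i) hf]
  exact (ENNReal.sum_le_tsum _).trans_eq (ENNReal.tsum_geometric _)

/-- The weighted sum `∑_{t ≤ j} 2^{-(j-t)/2} (E_j d)(x + e_t)` of translated dyadic means. -/
noncomputable def weightedMean (j : ℕ) (d : G → ℝ≥0∞) (x : G) : ℝ≥0∞ :=
  ∑ t ∈ Finset.range (j + 1), ratio ^ (j - t) * dyadicMean j d (x + basisPoint t)

theorem weightedMean_mono (j : ℕ) {d d' : G → ℝ≥0∞} (h : d ≤ d') :
    weightedMean j d ≤ weightedMean j d' := fun _ =>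
  Finset.sum_le_sum fun _ _ => mul_le_mul_right (dyadicMean_mono j h _) _

theorem weightedMean_sum (j : ℕ) {ι : Type*} (s : Finset ι) {d : ι → G → ℝ≥0∞}
    (hd : ∀ i ∈ s, Measurable (d i)) (x : G) :
    weightedMean j (fun y => ∑ i ∈ s, d i y) x = ∑ i ∈ s, weightedMean j (d i) x := by
  simp only [weightedMean, dyadicMean_sum j s hd, Finset.mul_sum]
  exact Finset.sum_comm

theorem measurable_dyadicMean_add (j : ℕ) (d : G → ℝ≥0∞) (z : G) :
    Measurable fun x => dyadicMean j d (x + z) :=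
  (measurable_of_dependsOn (dependsOn_dyadicMean j d)).comp (measurable_add_const z)

theorem measurable_weightedMean (j : ℕ) (d : G → ℝ≥0∞) : Measurable (weightedMean j d) :=
  Finset.measurable_sum _ fun _ _ => (measurable_dyadicMean_add j d _).const_mul _

theorem lintegral_weightedMean_le (j : ℕ) {d : G → ℝ≥0∞} (hd : Measurable d) :
    ∫⁻ x, weightedMean j d x ∂haar ≤ geomConst * ∫⁻ x, d x ∂haar := by
  have hinj : Set.InjOn (fun t => j - t) (Finset.range (j + 1)) := fun a ha b hb hab => by
    simp only [Finset.coe_range, Set.mem_Iio] at ha hb hab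
    omega
  calc ∫⁻ x, weightedMean j d x ∂haar
      = ∑ t ∈ Finset.range (j + 1), ratio ^ (j - t) * ∫⁻ x, d x ∂haar := by
        simp only [weightedMean]
        rw [lintegral_finsetSum _ fun _ _ => (measurable_dyadicMean_add j d _).const_mul _]
        refine Finset.sum_congr rfl fun t _ => ?_
        rw [lintegral_const_mul _ (measurable_dyadicMean_add j d _),
          lintegral_add_right_eq_self, lintegral_dyadicMean j hd]
    _ ≤ geomConst * ∫⁻ x, d x ∂haar := by
        rw [← Finset.sum_mul]
        gcongr
        exact sum_ratio_pow_le hinj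

theorem weightedMean_le_of_dependsOn {l j : ℕ} (h : l ≤ j) {d : G → ℝ≥0∞}
    (hd : DependsOn d (Set.Iio l)) (x : G) :
    weightedMean j d x ≤ geomConst * d x + ratio ^ (j - l) * weightedMean l d x := by
  have hinj : Set.InjOn (fun t => j - t) (Finset.Ico l (j + 1)) := fun a ha b hb hab => by
    simp only [Finset.coe_Ico, Set.mem_Ico] at ha hb hab
    omega
  have hlow : ∑ t ∈ Finset.range l, ratio ^ (j - t) * d (x + basisPoint t) ≤
      ratio ^ (j - l) * ∑ t ∈ Finset.range (l + 1), ratio ^ (l - t) * d (x + basisPoint t) := by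
    rw [Finset.mul_sum]
    refine (Finset.sum_le_sum fun t ht => ?_).trans
      (Finset.sum_le_sum_of_subset (Finset.range_subset_range.2 l.le_succ))
    have htl := Finset.mem_range.1 ht
    rw [← mul_assoc, ← pow_add, show j - l + (l - t) = j - t by omega]
  have hhigh : ∑ t ∈ Finset.Ico l (j + 1), ratio ^ (j - t) * d (x + basisPoint t) ≤
      geomConst * d x := by
    calc _ = ∑ t ∈ Finset.Ico l (j + 1), ratio ^ (j - t) * d x :=
          Finset.sum_congr rfl fun t ht => by
            rw [apply_add_basisPoint_of_dependsOn hd (Finset.mem_Ico.1 ht).1]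
      _ ≤ geomConst * d x := by
          rw [← Finset.sum_mul]
          gcongr
          exact sum_ratio_pow_le hinj
  rw [weightedMean, weightedMean, dyadicMean_of_dependsOn h hd, dyadicMean_of_dependsOn le_rfl hd,
    ← Finset.sum_range_add_sum_Ico _ (h.trans j.le_succ), add_comm]
  exact add_le_add hhigh hlow

/-- The convolution kernel of `weightedMean j`. -/
noncomputable def weightedKernel (j : ℕ) (z : G) : ℝ≥0∞ :=
  ∑ t ∈ Finset.range (j + 1), ratio ^ (j - t) * (2 ^ j * (interval j (basisPoint t)).indicator 1 z)

theorem measurable_weightedKernel (j : ℕ) : Measurable (weightedKernel j) :=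
  Finset.measurable_sum _ fun _ _ =>
    ((measurable_one.indicator (measurableSet_interval j _)).const_mul _).const_mul _

theorem lintegral_weightedKernel_mul (j : ℕ) (x : G) {g : G → ℝ≥0∞} (hg : Measurable g) :
    ∫⁻ y, weightedKernel j (x + y) * g y ∂haar = weightedMean j g x := by
  have hind (t : ℕ) :
      Measurable fun y => (interval j (basisPoint t)).indicator (1 : G → ℝ≥0∞) (x + y) * g y :=
    ((measurable_one.indicator (measurableSet_interval j _)).comp (measurable_const_add x)).mul hg
  simp only [weightedKernel, Finset.sum_mul, mul_assoc]
  rw [lintegral_finsetSum _ fun t _ => ((hind t).const_mul _).const_mul _]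
  refine Finset.sum_congr rfl fun t _ => ?_
  rw [lintegral_const_mul _ ((hind t).const_mul _), lintegral_const_mul _ (hind t),
    lintegral_indicator_interval_add_mul, ← mul_assoc (2 ^ j),
    ENNReal.mul_inv_cancel (by simp) (by simp), one_mul]

end WeightedMeans

section FejerMeans

theorem rpow_sum_le_sum_rpow {ι : Type*} (s : Finset ι) (f : ι → ℝ≥0∞) {p : ℝ} (hp : 0 < p)
    (hp1 : p ≤ 1) : (∑ i ∈ s, f i) ^ p ≤ ∑ i ∈ s, f i ^ p :=
  Finset.le_sum_of_subadditive (fun a : ℝ≥0∞ => a ^ p) (ENNReal.zero_rpow_of_pos hp).le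
    (fun a b => ENNReal.rpow_add_le_add_rpow a b hp.le hp1) s f

theorem enorm_fejerSum_beta_le {s k : ℕ} (h : k ≤ s) (z : G) :
    ‖fejerSum (beta s k) z‖ₑ ≤ ∑ j ∈ Finset.Icc k s, ∑ t ∈ Finset.range (j + 1),
      2 * (2 ^ (t + j) * (interval j (basisPoint t)).indicator 1 z) := by
  classical
  have hterm (j t : ℕ) : ENNReal.ofReal (2 * (2 ^ t * dirichlet (2 ^ j) (z + basisPoint t))) =
      2 * (2 ^ (t + j) * (interval j (basisPoint t)).indicator 1 z) := by
    rw [dirichlet_two_pow_add_apply, Set.indicator_apply, Set.indicator_apply, pow_add]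
    split_ifs <;> simp [ENNReal.ofReal_mul, ENNReal.ofReal_pow]
  have hnonneg (j t : ℕ) : 0 ≤ 2 * (2 ^ t * dirichlet (2 ^ j) (z + basisPoint t)) :=
    mul_nonneg zero_le_two (mul_nonneg (by positivity) (dirichlet_two_pow_nonneg j _))
  rw [Real.enorm_eq_ofReal_abs]
  refine (ENNReal.ofReal_le_ofReal (abs_fejerSum_beta_le h z)).trans_eq ?_
  simp only [dirichletTranslates, Finset.mul_sum]
  rw [ENNReal.ofReal_sum_of_nonneg fun _ _ => Finset.sum_nonneg fun _ _ => hnonneg _ _]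
  refine Finset.sum_congr rfl fun j _ => ?_
  rw [ENNReal.ofReal_sum_of_nonneg fun _ _ => hnonneg _ _]
  exact Finset.sum_congr rfl fun t _ => hterm j t

theorem two_pow_mul_enorm_fejerSum_beta_div_le {s k : ℕ} (h : k ≤ s) (z : G) :
    2 ^ (s + 1) * (‖fejerSum (beta s k) z‖ₑ / beta s k) ≤
      2 ^ (2 : ℝ) * ∑ j ∈ Finset.Icc k s, ∑ t ∈ Finset.range (j + 1),
        2 ^ (t + j) * (interval j (basisPoint t)).indicator 1 z := by
  have hβ : (2 : ℝ≥0∞) ^ s ≤ beta s k := by exact_mod_cast two_pow_le_beta h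
  calc _ ≤ 2 ^ (s + 1) * (‖fejerSum (beta s k) z‖ₑ / 2 ^ s) := by gcongr
    _ = 2 * ‖fejerSum (beta s k) z‖ₑ := by
        rw [pow_succ', mul_assoc, ENNReal.mul_div_cancel (by simp) (by simp)]
    _ ≤ _ := by
        refine (mul_le_mul_right (enorm_fejerSum_beta_le h z) 2).trans_eq ?_
        simp only [← Finset.mul_sum]
        rw [ENNReal.rpow_two, sq, mul_assoc]

theorem rpow_half_fejerSum_beta_le {s k : ℕ} (h : k ≤ s) (z : G) :
    (2 ^ (s + 1) * (‖fejerSum (beta s k) z‖ₑ / beta s k)) ^ (1 / 2 : ℝ) ≤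
      2 * ∑ j ∈ Finset.Icc k s, weightedKernel j z := by
  classical
  have hroot (j t : ℕ) (ht : t ∈ Finset.range (j + 1)) :
      (2 ^ (t + j) * (interval j (basisPoint t)).indicator (1 : G → ℝ≥0∞) z) ^ (1 / 2 : ℝ) =
        ratio ^ (j - t) * (2 ^ j * (interval j (basisPoint t)).indicator 1 z) := by
    rw [ENNReal.mul_rpow_of_nonneg _ _ (by norm_num),
      two_pow_add_rpow_half (Finset.mem_range_succ_iff.1 ht), mul_assoc, Set.indicator_apply]
    split_ifs <;> simp
  calc _ ≤ (2 ^ (2 : ℝ) * ∑ j ∈ Finset.Icc k s, ∑ t ∈ Finset.range (j + 1),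
        2 ^ (t + j) * (interval j (basisPoint t)).indicator (1 : G → ℝ≥0∞) z) ^ (1 / 2 : ℝ) := by
        exact ENNReal.rpow_le_rpow (two_pow_mul_enorm_fejerSum_beta_div_le h z) one_half_pos.le
    _ ≤ 2 * ∑ j ∈ Finset.Icc k s, ∑ t ∈ Finset.range (j + 1),
        (2 ^ (t + j) * (interval j (basisPoint t)).indicator (1 : G → ℝ≥0∞) z) ^
          (1 / 2 : ℝ) := by
        rw [ENNReal.mul_rpow_of_nonneg _ _ (by norm_num), one_div,
          ENNReal.rpow_rpow_inv two_ne_zero]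
        gcongr
        exact (rpow_sum_le_sum_rpow _ _ (by norm_num) (by norm_num)).trans
          (Finset.sum_le_sum fun _ _ => rpow_sum_le_sum_rpow _ _ (by norm_num) (by norm_num))
    _ = 2 * ∑ j ∈ Finset.Icc k s, weightedKernel j z := congrArg _ <|
        Finset.sum_congr rfl fun j _ => Finset.sum_congr rfl fun t ht => hroot j t ht

variable {𝕜 : Type*} [RCLike 𝕜] {F : ℕ → G → 𝕜}

theorem dependsOn_of_martingale (hF : Martingale F dyadicFiltration haar) (m : ℕ) :
    DependsOn (F m) (Set.Iio m) :=
  dependsOn_of_measurable (hF.stronglyMeasurable m).measurable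

theorem integrable_mul_of_dependsOn {f : G → 𝕜} {g : G → ℝ} {m : ℕ}
    (hf : DependsOn f (Set.Iio m)) (hg : DependsOn g (Set.Iio m)) (x : G) :
    Integrable (fun y => f y * (g (x + y) : 𝕜)) haar :=
  integrable_of_dependsOn fun _ _ hyz =>
    congrArg₂ (fun a (b : ℝ) => a * (b : 𝕜)) (hf hyz) (dependsOn_comp_const_add hg x hyz)

theorem integral_walsh_eq (hF : Martingale F dyadicFiltration haar) {i m n : ℕ} (hi : i < 2 ^ m)
    (hmn : m ≤ n) :
    ∫ x, F n x * (walsh i x : 𝕜) ∂haar = ∫ x, F m x * (walsh i x : 𝕜) ∂haar := by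
  have hsmul (l : ℕ) : (fun x => F l x * (walsh i x : 𝕜)) = walsh i • F l := by
    ext x
    rw [Pi.smul_apply', RCLike.real_smul_eq_coe_mul, mul_comm]
  have hwalsh : StronglyMeasurable[dyadicFiltration m] (walsh i) :=
    (measurable_dyadicFiltration_of_dependsOn (dependsOn_walsh hi)).stronglyMeasurable
  have hint : Integrable (walsh i • F n) haar := by
    simpa only [← hsmul, zero_add] using integrable_mul_of_dependsOn
      (dependsOn_of_martingale hF n) ((dependsOn_walsh hi).mono (Set.Iio_subset_Iio hmn)) 0
  rw [hsmul, hsmul, ← integral_condExp (dyadicFiltration.le m)]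
  refine integral_congr_ae ?_
  filter_upwards [hF.condExp_ae_eq hmn,
    condExp_smul_of_aestronglyMeasurable_left hwalsh.aestronglyMeasurable
      hint (hF.integrable n)] with x hmart hpull
  rw [hpull, Pi.smul_apply', hmart, Pi.smul_apply']

theorem fourierCoeff_eq (hF : Martingale F dyadicFiltration haar) {i m : ℕ} (hi : i < 2 ^ m) :
    fourierCoeff F i = ∫ x, F m x * (walsh i x : 𝕜) ∂haar := by
  refine Tendsto.limUnder_eq (tendsto_const_nhds.congr' ?_)
  filter_upwards [eventually_ge_atTop m] with n hn
  exact (integral_walsh_eq hF hi hn).symm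

theorem partialSum_eq (hF : Martingale F dyadicFiltration haar) {M m : ℕ} (hM : M ≤ 2 ^ m)
    (x : G) : partialSum F M x = ∫ y, F m y * (dirichlet M (x + y) : 𝕜) ∂haar := by
  have hlt {i : ℕ} (hi : i ∈ Finset.range M) : i < 2 ^ m := (Finset.mem_range.1 hi).trans_le hM
  simp only [dirichlet, RCLike.ofReal_sum, Finset.mul_sum]
  rw [integral_finsetSum _ fun i hi => integrable_mul_of_dependsOn
    (dependsOn_of_martingale hF m) (dependsOn_walsh (hlt hi)) x, partialSum]
  refine Finset.sum_congr rfl fun i hi => ?_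
  rw [fourierCoeff_eq hF (hlt hi), ← integral_mul_const]
  refine integral_congr_ae (.of_forall fun y => ?_)
  simp only [walsh_add, RCLike.ofReal_mul]
  ring

theorem fejerMean_eq (hF : Martingale F dyadicFiltration haar) {M m : ℕ} (hM : M ≤ 2 ^ m)
    (x : G) :
    fejerMean F M x = (M : 𝕜)⁻¹ * ∫ y, F m y * (fejerSum M (x + y) : 𝕜) ∂haar := by
  have hle {l : ℕ} (hl : l ∈ Finset.range M) : l + 1 ≤ 2 ^ m :=
    (Finset.mem_range.1 hl).trans_le hM
  simp only [fejerSum, RCLike.ofReal_sum, Finset.mul_sum]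
  rw [integral_finsetSum _ fun l hl => integrable_mul_of_dependsOn
    (dependsOn_of_martingale hF m) (dependsOn_dirichlet (hle hl)) x, fejerMean,
    Finset.range_eq_Ico,
    Finset.sum_Ico_add' (fun l => ∫ y, F m y * (dirichlet l (x + y) : 𝕜) ∂haar), zero_add,
    Finset.Ico_add_one_right_eq_Icc]
  refine congrArg _ (Finset.sum_congr rfl fun l hl => ?_)
  exact partialSum_eq hF ((Finset.mem_Icc.1 hl).2.trans hM) x

theorem enorm_fejerMean_le (hF : Martingale F dyadicFiltration haar) {M m : ℕ} (hM0 : M ≠ 0)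
    (hM : M ≤ 2 ^ m) (x : G) :
    ‖fejerMean F M x‖ₑ ≤ ∫⁻ y, ‖F m y‖ₑ * (‖fejerSum M (x + y)‖ₑ / M) ∂haar := by
  rw [fejerMean_eq hF hM, ← integral_const_mul]
  refine (enorm_integral_le_lintegral_enorm _).trans_eq (lintegral_congr fun y => ?_)
  have hM' : (M : 𝕜) ≠ 0 := Nat.cast_ne_zero.2 hM0
  rw [mul_left_comm, enorm_mul, enorm_mul, enorm_inv hM', mul_comm (_⁻¹), ← div_eq_mul_inv]
  simp [enorm_eq_nnnorm]

theorem enorm_fejerMean_beta_rpow_half_le (hF : Martingale F dyadicFiltration haar) {s k : ℕ}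
    (h : k ≤ s) (x : G) :
    ‖fejerMean F (beta s k) x‖ₑ ^ (1 / 2 : ℝ) ≤
      2 * ∑ j ∈ Finset.Icc k s, weightedMean j (fun y => ‖F (s + 1) y‖ₑ ^ (1 / 2 : ℝ)) x := by
  have hFd := dependsOn_of_martingale hF (s + 1)
  have hβ : beta s k ≤ 2 ^ (s + 1) := (beta_lt s k).le
  have hβ0 : beta s k ≠ 0 := (Nat.two_pow_pos s |>.trans_le (two_pow_le_beta h)).ne'
  let K : G → ℝ≥0∞ := fun z => ‖fejerSum (beta s k) z‖ₑ / beta s k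
  let g : G → ℝ≥0∞ := fun y => ‖F (s + 1) y‖ₑ ^ (1 / 2 : ℝ)
  have hg : Measurable g := (measurable_of_dependsOn hFd).enorm.pow_const _
  have hdep : DependsOn (fun y => ‖F (s + 1) y‖ₑ * K (x + y)) (Set.Iio (s + 1)) :=
    fun _ _ hyz => congrArg₂ (fun a b => ‖a‖ₑ * (‖b‖ₑ / beta s k)) (hFd hyz)
      (dependsOn_comp_const_add (dependsOn_fejerSum hβ) x hyz)
  have hpoint (y : G) :
      (2 ^ (s + 1)) ^ (1 / 2 : ℝ) * (‖F (s + 1) y‖ₑ * K (x + y)) ^ (1 / 2 : ℝ) ≤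
        2 * ∑ j ∈ Finset.Icc k s, weightedKernel j (x + y) * g y :=
    calc _ = (2 ^ (s + 1) * K (x + y)) ^ (1 / 2 : ℝ) * g y := by
          simp only [g, ENNReal.mul_rpow_of_nonneg _ _ one_half_pos.le]
          ring
      _ ≤ _ := by
          rw [← Finset.sum_mul, ← mul_assoc]
          gcongr
          exact rpow_half_fejerSum_beta_le h (x + y)
  calc _ ≤ (∫⁻ y, ‖F (s + 1) y‖ₑ * K (x + y) ∂haar) ^ (1 / 2 : ℝ) := by
        gcongr
        exact enorm_fejerMean_le hF hβ0 hβ x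
    _ ≤ ∫⁻ y, (2 ^ (s + 1)) ^ (1 / 2 : ℝ) *
          (‖F (s + 1) y‖ₑ * K (x + y)) ^ (1 / 2 : ℝ) ∂haar := by
        rw [lintegral_const_mul _ ((measurable_of_dependsOn hdep).pow_const _)]
        convert lintegral_rpow_le_of_dependsOn hdep one_half_pos (by norm_num) using 3
        norm_num
    _ ≤ ∫⁻ y, 2 * ∑ j ∈ Finset.Icc k s, weightedKernel j (x + y) * g y ∂haar :=
        lintegral_mono hpoint
    _ = 2 * ∑ j ∈ Finset.Icc k s, weightedMean j g x := by
        have hmeas (j : ℕ) : Measurable fun y => weightedKernel j (x + y) * g y :=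
          ((measurable_weightedKernel j).comp (measurable_const_add x)).mul hg
        rw [lintegral_const_mul _ (Finset.measurable_sum _ fun j _ => hmeas j),
          lintegral_finsetSum _ fun j _ => hmeas j]
        simp only [lintegral_weightedKernel_mul _ _ hg]

end FejerMeans

section Increments

/-- The `l`-th increment of the running maximum of `f`, as a truncated difference: it vanishes
unless `f l` exceeds all earlier values. -/
noncomputable def maxIncrement (f : ℕ → ℝ≥0∞) (l : ℕ) : ℝ≥0∞ := f l - ⨆ i < l, f i

theorem sum_maxIncrement (f : ℕ → ℝ≥0∞) (m : ℕ) :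
    ∑ l ∈ Finset.range m, maxIncrement f l = ⨆ i < m, f i := by
  induction m with
  | zero => simp
  | succ m ih =>
    rw [Finset.sum_range_succ, ih, maxIncrement, add_tsub_eq_max, Nat.iSup_lt_succ]

theorem tsum_maxIncrement_le (f : ℕ → ℝ≥0∞) : ∑' l, maxIncrement f l ≤ ⨆ l, f l :=
  ENNReal.tsum_le_of_sum_range_le fun m => by
    rw [sum_maxIncrement]
    exact iSup₂_le fun i _ => le_iSup f i

theorem dependsOn_maxIncrement {f : ℕ → G → ℝ≥0∞} (hf : ∀ l, DependsOn (f l) (Set.Iio l))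
    (l : ℕ) : DependsOn (fun x => maxIncrement (fun i => f i x) l) (Set.Iio l) := fun _ _ hxy =>
  congrArg₂ (· - ·) (hf l hxy) <|
    biSup_congr fun i hi => (hf i).mono (Set.Iio_subset_Iio hi.le) hxy

end Increments

section BlockMaximal

/-- A majorant of the window averages `ρ(s)⁻¹ ∑_{k ≤ j ≤ s} weightedMean j d` with
`s < k + ρ(s)` and `l ≤ s + 1`, for `d` depending on the first `l` coordinates only. It involves
neither `s` nor `k`. -/
noncomputable def majorant (ρ : ℕ → ℕ) (l : ℕ) (d : G → ℝ≥0∞) (x : G) : ℝ≥0∞ :=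
  geomConst * d x + geomConst * weightedMean l d x +
    (ρ (l - 1) : ℝ≥0∞)⁻¹ * ∑ j ∈ Finset.Ico (l - ρ (l - 1)) l, weightedMean j d x

theorem measurable_majorant (ρ : ℕ → ℕ) (l : ℕ) {d : G → ℝ≥0∞} (hd : Measurable d) :
    Measurable (majorant ρ l d) :=
  ((hd.const_mul _).add ((measurable_weightedMean l d).const_mul _)).add
    ((Finset.measurable_sum _ fun j _ => measurable_weightedMean j d).const_mul _)

/-- A bound, uniform in `ρ` and `l`, for the operator `majorant ρ l` on `L¹(G)`. -/
noncomputable def majorantConst : ℝ≥0∞ := geomConst + geomConst * geomConst + geomConst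

theorem majorantConst_ne_top : majorantConst ≠ ∞ := by
  have := geomConst_ne_top
  unfold majorantConst
  finiteness

theorem lintegral_majorant_le (ρ : ℕ → ℕ) (l : ℕ) {d : G → ℝ≥0∞} (hd : Measurable d) :
    ∫⁻ x, majorant ρ l d x ∂haar ≤ majorantConst * ∫⁻ x, d x ∂haar := by
  have hmean (j : ℕ) := measurable_weightedMean j d
  have hsum : Measurable fun x => ∑ j ∈ Finset.Ico (l - ρ (l - 1)) l, weightedMean j d x :=
    Finset.measurable_sum _ fun j _ => hmean j
  have hwindow : (ρ (l - 1) : ℝ≥0∞)⁻¹ *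
      ∑ j ∈ Finset.Ico (l - ρ (l - 1)) l, ∫⁻ x, weightedMean j d x ∂haar ≤
        geomConst * ∫⁻ x, d x ∂haar :=
    calc _ ≤ (ρ (l - 1) : ℝ≥0∞)⁻¹ * (ρ (l - 1) * (geomConst * ∫⁻ x, d x ∂haar)) := by
          gcongr
          refine (Finset.sum_le_card_nsmul _ _ _ fun j _ => lintegral_weightedMean_le j hd).trans ?_
          rw [nsmul_eq_mul, Nat.card_Ico]
          gcongr
          omega
      _ ≤ _ := by
          rw [← mul_assoc]
          exact mul_le_of_le_one_left' (ENNReal.inv_mul_le_one _)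
  simp only [majorant]
  rw [lintegral_add_right _ (hsum.const_mul _), lintegral_add_right _ ((hmean l).const_mul _),
    lintegral_const_mul _ hd, lintegral_const_mul _ (hmean l), lintegral_const_mul _ hsum,
    lintegral_finsetSum _ fun j _ => hmean j, majorantConst, add_mul, add_mul, mul_assoc geomConst]
  gcongr
  exact lintegral_weightedMean_le l hd

theorem sum_weightedMean_le_of_dependsOn {l : ℕ} {s : Finset ℕ} (hs : ∀ j ∈ s, l ≤ j)
    {d : G → ℝ≥0∞} (hd : DependsOn d (Set.Iio l)) (x : G) :
    ∑ j ∈ s, weightedMean j d x ≤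
      s.card * (geomConst * d x) + geomConst * weightedMean l d x := by
  have hinj : Set.InjOn (fun j => j - l) s := fun a ha b hb hab => by
    have := hs a ha
    have := hs b hb
    simp only at hab
    omega
  calc _ ≤ ∑ j ∈ s, (geomConst * d x + ratio ^ (j - l) * weightedMean l d x) :=
        Finset.sum_le_sum fun j hj => weightedMean_le_of_dependsOn (hs j hj) hd x
    _ ≤ _ := by
        rw [Finset.sum_add_distrib, Finset.sum_const, nsmul_eq_mul, ← Finset.sum_mul]
        gcongr
        exact sum_ratio_pow_le hinj

theorem le_add_sub_of_succ_le {ρ : ℕ → ℕ} (hρ : ∀ s, ρ (s + 1) ≤ ρ s + 1) {a b : ℕ} (h : a ≤ b) :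
    ρ b ≤ ρ a + (b - a) := by
  induction b, h using Nat.le_induction with
  | base => simp
  | succ b hab ih => have := hρ b; omega

theorem inv_mul_sum_weightedMean_le {ρ : ℕ → ℕ} (hρ : Monotone ρ)
    (hρ1 : ∀ s, ρ (s + 1) ≤ ρ s + 1) {l s k : ℕ} (hl : l ≤ s + 1) (hks : k ≤ s)
    (hk : s < k + ρ s) {d : G → ℝ≥0∞} (hd : DependsOn d (Set.Iio l)) (x : G) :
    (ρ s : ℝ≥0∞)⁻¹ * ∑ j ∈ Finset.Icc k s, weightedMean j d x ≤ majorant ρ l d x := by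
  have hρ0 : 1 ≤ ρ s := by omega
  have hhigh : (ρ s : ℝ≥0∞)⁻¹ * ∑ j ∈ Finset.Icc k s with l ≤ j, weightedMean j d x ≤
      geomConst * d x + geomConst * weightedMean l d x := by
    have hcard : ((Finset.Icc k s).filter (l ≤ ·)).card ≤ ρ s :=
      (Finset.card_filter_le _ _).trans (by rw [Nat.card_Icc]; omega)
    calc _ ≤ (ρ s : ℝ≥0∞)⁻¹ * (ρ s * (geomConst * d x) + geomConst * weightedMean l d x) := by
          refine mul_le_mul_right ((sum_weightedMean_le_of_dependsOn
            (fun j hj => (Finset.mem_filter.1 hj).2) hd x).trans ?_) _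
          gcongr
      _ ≤ _ := by
          rw [mul_add, ← mul_assoc]
          refine add_le_add (mul_le_of_le_one_left' (ENNReal.inv_mul_le_one _))
            (mul_le_of_le_one_left' (ENNReal.inv_le_one.2 ?_))
          exact_mod_cast hρ0
  have hlow : (ρ s : ℝ≥0∞)⁻¹ * ∑ j ∈ Finset.Icc k s with ¬l ≤ j, weightedMean j d x ≤
      (ρ (l - 1) : ℝ≥0∞)⁻¹ * ∑ j ∈ Finset.Ico (l - ρ (l - 1)) l, weightedMean j d x := by
    rcases Nat.eq_zero_or_pos l with rfl | hl0
    · simp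
    have hmono : ρ (l - 1) ≤ ρ s := hρ (by omega)
    have hgrowth : ρ s ≤ ρ (l - 1) + (s - (l - 1)) := le_add_sub_of_succ_le hρ1 (by omega)
    gcongr
    intro j hj
    simp only [Finset.mem_filter, Finset.mem_Icc, Finset.mem_Ico] at hj ⊢
    omega
  rw [← Finset.sum_filter_add_sum_filter_not _ (l ≤ ·), mul_add, majorant]
  exact add_le_add hhigh hlow

/-- The maximal operator `sup_{s, k} ρ(s)⁻¹ ∑_{k ≤ j ≤ s} weightedMean j f_{s+1}` over the windows
`s - ρ(s) < k ≤ s`. -/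
noncomputable def blockMaximal (ρ : ℕ → ℕ) (f : ℕ → G → ℝ≥0∞) (x : G) : ℝ≥0∞ :=
  ⨆ (s : ℕ) (k : ℕ) (_ : k ≤ s ∧ s < k + ρ s),
    (ρ s : ℝ≥0∞)⁻¹ * ∑ j ∈ Finset.Icc k s, weightedMean j (f (s + 1)) x

theorem measurable_blockMaximal (ρ : ℕ → ℕ) (f : ℕ → G → ℝ≥0∞) : Measurable (blockMaximal ρ f) :=
  .iSup fun _ => .iSup fun _ => .iSup fun _ =>
    (Finset.measurable_sum _ fun j _ => measurable_weightedMean j _).const_mul _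

theorem blockMaximal_le_tsum_majorant {ρ : ℕ → ℕ} (hρ : Monotone ρ)
    (hρ1 : ∀ s, ρ (s + 1) ≤ ρ s + 1) {f : ℕ → G → ℝ≥0∞}
    (hf : ∀ l, DependsOn (f l) (Set.Iio l)) (x : G) :
    blockMaximal ρ f x ≤
      ∑' l, majorant ρ l (fun y => maxIncrement (fun i => f i y) l) x := by
  let d : ℕ → G → ℝ≥0∞ := fun l y => maxIncrement (fun i => f i y) l
  have hd (l : ℕ) : DependsOn (d l) (Set.Iio l) := dependsOn_maxIncrement hf l
  refine iSup_le fun s => iSup₂_le fun k ⟨hks, hk⟩ => ?_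
  have htelescope : f (s + 1) ≤ fun y => ∑ l ∈ Finset.range (s + 2), d l y := fun y => by
    simp only [d, sum_maxIncrement]
    exact le_iSup₂_of_le (s + 1) (by omega) le_rfl
  calc (ρ s : ℝ≥0∞)⁻¹ * ∑ j ∈ Finset.Icc k s, weightedMean j (f (s + 1)) x
      ≤ (ρ s : ℝ≥0∞)⁻¹ * ∑ j ∈ Finset.Icc k s,
          weightedMean j (fun y => ∑ l ∈ Finset.range (s + 2), d l y) x := by
        gcongr with j
        exact weightedMean_mono j htelescope x
    _ = ∑ l ∈ Finset.range (s + 2),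
          (ρ s : ℝ≥0∞)⁻¹ * ∑ j ∈ Finset.Icc k s, weightedMean j (d l) x := by
        simp only [weightedMean_sum _ _ fun l _ => measurable_of_dependsOn (hd l)]
        rw [Finset.sum_comm, Finset.mul_sum]
    _ ≤ ∑ l ∈ Finset.range (s + 2), majorant ρ l (d l) x :=
        Finset.sum_le_sum fun l hl => inv_mul_sum_weightedMean_le hρ hρ1
          (Nat.lt_succ_iff.1 (Finset.mem_range.1 hl)) hks hk (hd l) x
    _ ≤ ∑' l, majorant ρ l (d l) x := ENNReal.sum_le_tsum _

theorem lintegral_blockMaximal_le {ρ : ℕ → ℕ} (hρ : Monotone ρ)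
    (hρ1 : ∀ s, ρ (s + 1) ≤ ρ s + 1) {f : ℕ → G → ℝ≥0∞}
    (hf : ∀ l, DependsOn (f l) (Set.Iio l)) :
    ∫⁻ x, blockMaximal ρ f x ∂haar ≤ majorantConst * ∫⁻ x, ⨆ l, f l x ∂haar := by
  have hd (l : ℕ) := measurable_of_dependsOn (dependsOn_maxIncrement hf l)
  calc ∫⁻ x, blockMaximal ρ f x ∂haar
      ≤ ∫⁻ x, ∑' l, majorant ρ l (fun y => maxIncrement (fun i => f i y) l) x ∂haar :=
        lintegral_mono (blockMaximal_le_tsum_majorant hρ hρ1 hf)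
    _ = ∑' l, ∫⁻ x, majorant ρ l (fun y => maxIncrement (fun i => f i y) l) x ∂haar :=
        lintegral_tsum fun l => (measurable_majorant ρ l (hd l)).aemeasurable
    _ ≤ ∑' l, majorantConst * ∫⁻ x, maxIncrement (fun i => f i x) l ∂haar :=
        ENNReal.tsum_le_tsum fun l => lintegral_majorant_le ρ l (hd l)
    _ = majorantConst * ∫⁻ x, ∑' l, maxIncrement (fun i => f i x) l ∂haar := by
        rw [ENNReal.tsum_mul_left, lintegral_tsum fun l => (hd l).aemeasurable]
    _ ≤ majorantConst * ∫⁻ x, ⨆ l, f l x ∂haar := by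
        gcongr with x
        exact tsum_maxIncrement_le _

end BlockMaximal

section WeightedMaximal

variable {𝕜 : Type*} [RCLike 𝕜]

/-- The weighted maximal operator `sup_{s, k} |σ_{β_k^s} F| / w(s, k)` over the pairs `(s, k)`
satisfying `P`. -/
noncomputable def weightedMaximal (P : ℕ → ℕ → Prop) (w : ℕ → ℕ → ℝ≥0∞) (F : ℕ → G → 𝕜)
    (x : G) : ℝ≥0∞ :=
  ⨆ (s : ℕ) (k : ℕ) (_ : P s k), ‖fejerMean F (beta s k) x‖ₑ / w s k

theorem measurable_fejerMean (F : ℕ → G → 𝕜) (M : ℕ) : Measurable (fejerMean F M) := by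
  have hwalsh (i : ℕ) : Measurable fun x => (walsh i x : 𝕜) :=
    RCLike.measurable_ofReal.comp (measurable_of_dependsOn (dependsOn_walsh Nat.lt_two_pow_self))
  exact (Finset.measurable_sum _ fun _ _ => Finset.measurable_sum _ fun i _ =>
    (hwalsh i).const_mul _).const_mul _

theorem measurable_weightedMaximal (P : ℕ → ℕ → Prop) (w : ℕ → ℕ → ℝ≥0∞) (F : ℕ → G → 𝕜) :
    Measurable (weightedMaximal P w F) :=
  .iSup fun _ => .iSup fun _ => .iSup fun _ => (measurable_fejerMean F _).enorm.div_const _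

theorem weightedMaximal_rpow_half_le {ρ : ℕ → ℕ} {P : ℕ → ℕ → Prop} {w : ℕ → ℕ → ℝ≥0∞}
    {c : ℝ≥0∞} (hP : ∀ s k, P s k → k ≤ s ∧ s < k + ρ s)
    (hw : ∀ s k, P s k → (ρ s : ℝ≥0∞) ^ 2 ≤ c * w s k) {F : ℕ → G → 𝕜}
    (hF : Martingale F dyadicFiltration haar) (x : G) :
    weightedMaximal P w F x ^ (1 / 2 : ℝ) ≤
      2 * c ^ (1 / 2 : ℝ) * blockMaximal ρ (fun l y => ‖F l y‖ₑ ^ (1 / 2 : ℝ)) x := by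
  rw [one_div, ENNReal.rpow_inv_le_iff two_pos]
  refine iSup_le fun s => iSup₂_le fun k hsk => ?_
  rw [← ENNReal.rpow_inv_le_iff two_pos, ← one_div]
  have hρ0 : (ρ s : ℝ≥0∞) ^ 2 ≠ 0 := by
    have := hP s k hsk
    exact pow_ne_zero 2 (Nat.cast_ne_zero.2 (by omega))
  have hweight : (w s k)⁻¹ ≤ c * ((ρ s : ℝ≥0∞) ^ 2)⁻¹ := by
    rw [← div_eq_mul_inv, ENNReal.le_div_iff_mul_le (.inl hρ0) (.inl (by finiteness)), mul_comm,
      ← div_eq_mul_inv]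
    exact ENNReal.div_le_of_le_mul (hw s k hsk)
  calc (‖fejerMean F (beta s k) x‖ₑ / w s k) ^ (1 / 2 : ℝ)
      ≤ (‖fejerMean F (beta s k) x‖ₑ * (c * ((ρ s : ℝ≥0∞) ^ 2)⁻¹)) ^ (1 / 2 : ℝ) := by
        rw [div_eq_mul_inv]
        gcongr
    _ = ‖fejerMean F (beta s k) x‖ₑ ^ (1 / 2 : ℝ) * (c ^ (1 / 2 : ℝ) * (ρ s : ℝ≥0∞)⁻¹) := by
        rw [ENNReal.mul_rpow_of_nonneg _ _ one_half_pos.le,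
          ENNReal.mul_rpow_of_nonneg _ _ one_half_pos.le, ENNReal.inv_rpow, one_div,
          ← ENNReal.rpow_two, ENNReal.rpow_rpow_inv two_ne_zero]
    _ ≤ (2 * ∑ j ∈ Finset.Icc k s, weightedMean j (fun y => ‖F (s + 1) y‖ₑ ^ (1 / 2 : ℝ)) x) *
          (c ^ (1 / 2 : ℝ) * (ρ s : ℝ≥0∞)⁻¹) := by
        gcongr
        exact enorm_fejerMean_beta_rpow_half_le hF (hP s k hsk).1 x
    _ = 2 * c ^ (1 / 2 : ℝ) * ((ρ s : ℝ≥0∞)⁻¹ *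
          ∑ j ∈ Finset.Icc k s, weightedMean j (fun y => ‖F (s + 1) y‖ₑ ^ (1 / 2 : ℝ)) x) := by
        ring
    _ ≤ _ := by
        gcongr
        exact le_iSup_of_le s (le_iSup₂_of_le k (hP s k hsk) le_rfl)

theorem eLpNorm_half_eq (f : G → ℝ≥0∞) :
    eLpNorm f (1 / 2) haar = (∫⁻ x, f x ^ (1 / 2 : ℝ) ∂haar) ^ (2 : ℝ) := by
  rw [eLpNorm_eq_lintegral_rpow_enorm_toReal (by simp) (by simp)]
  simp

theorem eLpNorm_weightedMaximal_le {ρ : ℕ → ℕ} (hρ : Monotone ρ)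
    (hρ1 : ∀ s, ρ (s + 1) ≤ ρ s + 1) {P : ℕ → ℕ → Prop} {w : ℕ → ℕ → ℝ≥0∞} {c : ℝ≥0∞}
    (hP : ∀ s k, P s k → k ≤ s ∧ s < k + ρ s)
    (hw : ∀ s k, P s k → (ρ s : ℝ≥0∞) ^ 2 ≤ c * w s k) {F : ℕ → G → 𝕜}
    (hF : Martingale F dyadicFiltration haar) :
    eLpNorm (weightedMaximal P w F) (1 / 2) haar ≤
      (2 * c ^ (1 / 2 : ℝ) * majorantConst) ^ (2 : ℝ) * hardyNorm (1 / 2) F := by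
  have hdep (l : ℕ) : DependsOn (fun y => ‖F l y‖ₑ ^ (1 / 2 : ℝ)) (Set.Iio l) := fun _ _ hyz =>
    congrArg (‖·‖ₑ ^ (1 / 2 : ℝ)) (dependsOn_of_martingale hF l hyz)
  have hmaximal (x : G) : ⨆ l, ‖F l x‖ₑ ^ (1 / 2 : ℝ) ≤ maximalFunction F x ^ (1 / 2 : ℝ) :=
    iSup_le fun l => ENNReal.rpow_le_rpow (le_iSup (fun i => ‖F i x‖ₑ) l) one_half_pos.le
  rw [hardyNorm, eLpNorm_half_eq, eLpNorm_half_eq,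
    ← ENNReal.mul_rpow_of_nonneg _ _ zero_le_two]
  gcongr
  calc ∫⁻ x, weightedMaximal P w F x ^ (1 / 2 : ℝ) ∂haar
      ≤ ∫⁻ x, 2 * c ^ (1 / 2 : ℝ) *
          blockMaximal ρ (fun l y => ‖F l y‖ₑ ^ (1 / 2 : ℝ)) x ∂haar :=
        lintegral_mono (weightedMaximal_rpow_half_le hP hw hF)
    _ = 2 * c ^ (1 / 2 : ℝ) *
          ∫⁻ x, blockMaximal ρ (fun l y => ‖F l y‖ₑ ^ (1 / 2 : ℝ)) x ∂haar :=
        lintegral_const_mul _ (measurable_blockMaximal ρ _)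
    _ ≤ 2 * c ^ (1 / 2 : ℝ) * (majorantConst * ∫⁻ x, ⨆ l, ‖F l x‖ₑ ^ (1 / 2 : ℝ) ∂haar) := by
        gcongr
        exact lintegral_blockMaximal_le hρ hρ1 hdep
    _ ≤ 2 * c ^ (1 / 2 : ℝ) * majorantConst *
          ∫⁻ x, maximalFunction F x ^ (1 / 2 : ℝ) ∂haar := by
        rw [← mul_assoc]
        gcongr with x
        exact hmaximal x

end WeightedMaximal

section RootWeights

theorem rootFloor_mono (n : ℕ) : Monotone (rootFloor n) := fun a b h =>
  Nat.floor_le_floor (Real.rpow_le_rpow (by positivity) (by exact_mod_cast h) (by positivity))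

theorem one_div_natCast_le_one (n : ℕ) : 1 / (n : ℝ) ≤ 1 :=
  (one_div _).trans_le (Nat.cast_inv_le_one n)

theorem rootFloor_succ_le (n s : ℕ) : rootFloor n (s + 1) ≤ rootFloor n s + 1 := by
  rw [rootFloor, rootFloor, ← Nat.floor_add_one (by positivity)]
  refine Nat.floor_le_floor ?_
  simpa using Real.rpow_add_le_add_rpow s.cast_nonneg zero_le_one (by positivity)
    (one_div_natCast_le_one n)

theorem half_mul_le_log_beta {s k : ℕ} (h : k ≤ s) : 1 / 2 * (s : ℝ) ≤ Real.log (beta s k) :=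
  calc 1 / 2 * (s : ℝ) ≤ s * Real.log 2 := by
        rw [mul_comm]
        gcongr
        linarith [Real.log_two_gt_d9]
    _ = Real.log (2 ^ s) := (Real.log_pow (x := 2) (n := s)).symm
    _ ≤ Real.log (beta s k) :=
        Real.log_le_log (by positivity) (by exact_mod_cast two_pow_le_beta h)

theorem rootFloor_add_two_le (n : ℕ) {s k : ℕ} (hs : 1 ≤ s) (hk : k ≤ s) :
    (rootFloor n s + 2 : ℝ) ≤ 6 * Real.log (beta s k) ^ (1 / (n : ℝ)) := by
  have hfloor : (rootFloor n s : ℝ) ≤ (s : ℝ) ^ (1 / (n : ℝ)) := Nat.floor_le (by positivity)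
  have hone : 1 ≤ (s : ℝ) ^ (1 / (n : ℝ)) :=
    Real.one_le_rpow (by exact_mod_cast hs) (by positivity)
  have hhalf : 1 / 2 ≤ (1 / 2 : ℝ) ^ (1 / (n : ℝ)) :=
    Real.self_le_rpow_of_le_one (by norm_num) (by norm_num) (one_div_natCast_le_one n)
  have hlog : 1 / 2 * (s : ℝ) ^ (1 / (n : ℝ)) ≤ Real.log (beta s k) ^ (1 / (n : ℝ)) :=
    calc _ ≤ (1 / 2) ^ (1 / (n : ℝ)) * (s : ℝ) ^ (1 / (n : ℝ)) := by gcongr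
      _ = (1 / 2 * (s : ℝ)) ^ (1 / (n : ℝ)) :=
        (Real.mul_rpow (by norm_num) s.cast_nonneg).symm
      _ ≤ _ := Real.rpow_le_rpow (by positivity) (half_mul_le_log_beta hk) (by positivity)
  linarith

theorem sq_rootFloor_add_two_le (n : ℕ) {s k : ℕ} (hs : 1 ≤ s) (hk : k ≤ s) :
    ((rootFloor n s + 2 : ℕ) : ℝ≥0∞) ^ 2 ≤
      (36 : ℝ≥0) * ENNReal.ofReal (Real.log (beta s k) ^ (2 / (n : ℝ))) := by
  have hlog : 0 ≤ Real.log (beta s k) := Real.log_natCast_nonneg _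
  have hreal : (rootFloor n s + 2 : ℝ) ^ 2 ≤ 36 * Real.log (beta s k) ^ (2 / (n : ℝ)) :=
    calc _ ≤ (6 * Real.log (beta s k) ^ (1 / (n : ℝ))) ^ 2 := by
          gcongr
          exact rootFloor_add_two_le n hs hk
      _ = _ := by
          rw [mul_pow, ← Real.rpow_mul_natCast hlog, one_div_mul_eq_div]
          norm_num
  convert ENNReal.ofReal_le_ofReal hreal using 1
  · rw [ENNReal.ofReal_pow (by positivity), ← ENNReal.ofReal_natCast]
    push_cast
    rfl
  · rw [ENNReal.ofReal_mul (by norm_num)]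
    simp

end RootWeights

end WalshFejer

theorem corollary6_general {𝕜 : Type*} [RCLike 𝕜] {ρ : ℕ → ℕ} (hρ : Monotone ρ)
    (hρ1 : ∀ s, ρ (s + 1) ≤ ρ s + 1) {P : ℕ → ℕ → Prop} {w : ℕ → ℕ → ℝ≥0∞} {c : ℝ≥0}
    (hP : ∀ s k, P s k → k ≤ s ∧ s < k + ρ s)
    (hw : ∀ s k, P s k → (ρ s : ℝ≥0∞) ^ 2 ≤ c * w s k) :
    ∃ C : ℝ≥0, ∀ F : ℕ → WalshFejer.G → 𝕜, WalshFejer.MemHardy (1 / 2) F →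
      MemLp (WalshFejer.weightedMaximal P w F) (1 / 2) WalshFejer.haar ∧
        eLpNorm (WalshFejer.weightedMaximal P w F) (1 / 2) WalshFejer.haar ≤
          C * WalshFejer.hardyNorm (1 / 2) F := by
  let C : ℝ≥0∞ := (2 * (c : ℝ≥0∞) ^ (1 / 2 : ℝ) * WalshFejer.majorantConst) ^ (2 : ℝ)
  have hC : C ≠ ∞ := by
    have := WalshFejer.majorantConst_ne_top
    finiteness
  refine ⟨C.toNNReal, fun F hF => ?_⟩
  have hbound : eLpNorm (WalshFejer.weightedMaximal P w F) (1 / 2) WalshFejer.haar ≤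
      C.toNNReal * WalshFejer.hardyNorm (1 / 2) F := by
    rw [ENNReal.coe_toNNReal hC]
    exact WalshFejer.eLpNorm_weightedMaximal_le hρ hρ1 hP hw hF.1
  exact ⟨⟨(WalshFejer.measurable_weightedMaximal P w F).aestronglyMeasurable,
    hbound.trans_lt (ENNReal.mul_lt_top ENNReal.coe_lt_top hF.2)⟩, hbound⟩

theorem corollary6 {𝕜 : Type*} [RCLike 𝕜] (n : ℕ) (hn : 1 ≤ n) :
    ∃ C : ℝ≥0, ∀ F : ℕ → WalshFejer.G → 𝕜, WalshFejer.MemHardy (1 / 2) F →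
      MemLp (WalshFejer.restrictedMaximal n F) (1 / 2) WalshFejer.haar ∧
        eLpNorm (WalshFejer.restrictedMaximal n F) (1 / 2) WalshFejer.haar ≤
          C * WalshFejer.hardyNorm (1 / 2) F :=
  corollary6_general (ρ := fun s => WalshFejer.rootFloor n s + 2)
    (fun _ _ h => Nat.add_le_add_right (WalshFejer.rootFloor_mono n h) 2)
    (fun s => by have := WalshFejer.rootFloor_succ_le n s; omega)
    (fun _ _ h => by omega)
    (fun _ _ h => WalshFejer.sq_rootFloor_add_two_le n (by omega) (by omega))
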